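/- Theorem. Let $d\ge 1$ be a fixed dimension. For a finite set $P\subset\mathbb{R}^d$ let $\mathcal{R}_P$ be the family of all distinct sets of the form $P\cap B$, where $B=[a_1,b_1]\times\dots\times[a_d,b_d]$ is an axis-parallel box, and for weights $x\in\mathbb{Z}^P$ and $R\in\mathcal{R}_P$ let $R(x)=\sum_{q\in R}x_q$. Let $U\subseteq\mathbb{Z}$ be a universe containing $0$ and $1$ (for example $\{0,1\}$ or $\mathbb{Z}$). A mechanism $M$ for $d$-dimensional orthogonal range counting assigns to every finite $P\subset\mathbb{R}^d$ (public) and every $x\in U^P$ (private) a random vector $M_P(x)=(M_P(x)_R)_{R\in\mathcal{R}_P}\in\mathbb{R}^{\mathcal{R}_P}$; its average squared error on $(P,x)$ is the random variable $\frac{1}{|\mathcal{R}_P|}\sum_{R\in\mathcal{R}_P}(M_P(x)_R-R(x))^2$. The mechanism is $(\varepsilon,\delta)$-differentially private if for all $P$, all $x,x'\in U^P$ with $\|x-x'\|_1\le 1$ and all measurable $S\subseteq\mathbb{R}^{\mathcal{R}_P}$, $$\Pr[M_P(x)\in S]\le e^{\varepsilon}\Pr[M_P(x')\in S]+\delta .$$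 Let $p>0$ be a constant and let $\mathrm{err}:\mathbb{N}\to\mathbb{R}$ satisfy $\mathrm{err}(n)=o((\log n)^{d-1})$ as $n\to\infty$. Suppose that $M$ is a mechanism such that for all sufficiently large $n$, every $P\subset\mathbb{R}^d$ with $|P|=n$ and every $x\in U^P$, with probability at least $p$ the average squared error of $M$ on $(P,x)$ is at most $\mathrm{err}(n)$. Then for all constants $\varepsilon\ge 0$ and $0\le\delta<p$, the mechanism $M$ is not $(\varepsilon,\delta)$-differentially private. -/

import Mathlib

open Filter Asymptotics MeasureTheory

/-- `M` is a randomized map on integer vectors with entries in the universe `U`, given by the law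
`M x` of its output on input `x`. It is `(ε, δ)`-differentially private if the output laws on any
two inputs at `ℓ₁`-distance at most `1` satisfy the usual inequality on all measurable sets. -/
def IsDifferentiallyPrivate {ι Y : Type*} [Fintype ι] [MeasurableSpace Y] {U : Set ℤ}
    (M : (ι → U) → ProbabilityMeasure Y) (ε δ : ℝ) : Prop :=
  ∀ x x' : ι → U, ∑ i, |(x i : ℤ) - (x' i : ℤ)| ≤ 1 →
    ∀ S : Set Y, MeasurableSet S →
      (M x : Measure Y).real S ≤ Real.exp ε * (M x' : Measure Y).real S + δ

open Classical in
/-- The range space induced on `P ⊆ ℝ^d` by axis-parallel boxes: the (distinct) subsets of `P` of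
the form `P ∩ B` with `B = [a₁, b₁] × ⋯ × [a_d, b_d]`. -/
noncomputable def boxRanges {d : ℕ} (P : Finset (Fin d → ℝ)) : Finset (Finset (Fin d → ℝ)) :=
  P.powerset.filter fun R => ∃ a b : Fin d → ℝ, (R : Set (Fin d → ℝ)) = ↑P ∩ Set.Icc a b

open Classical in
/-- The exact count `R(x) = ∑_{q ∈ R} x_q` of a range `R` for the weights `x` on `P`. -/
noncomputable def rangeCount {d : ℕ} {P : Finset (Fin d → ℝ)} {U : Set ℤ} (x : P → U)
    (R : Finset (Fin d → ℝ)) : ℝ :=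
  ∑ q : P, if (q : Fin d → ℝ) ∈ R then ((x q : ℤ) : ℝ) else 0

/-- The average squared error, over all box ranges on `P`, of the vector of answers `y`. -/
noncomputable def avgSqError {d : ℕ} {P : Finset (Fin d → ℝ)} {U : Set ℤ} (x : P → U)
    (y : boxRanges P → ℝ) : ℝ :=
  (1 / ((boxRanges P).card : ℝ)) * ∑ R : boxRanges P, (y R - rangeCount x R) ^ 2

/-- A mechanism for `d`-dimensional orthogonal range counting: the finite point set `P` is public,
the weights `x : P → U` are the private input, and the output is a random vector with one real
answer for each box range on `P`. -/
abbrev OrthogonalRangeMechanism (U : Set ℤ) (d : ℕ) : Type :=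
  ∀ P : Finset (Fin d → ℝ), (P → U) → ProbabilityMeasure (boxRanges P → ℝ)

/-! The proof combines a discrepancy lower bound with a reconstruction attack. Fix a base `r`, a
prime depending only on `d`, `p`, `ε`, `δ`. Build `N = r ^ h` grid points such that any two `0`/`1`
weightings differing on more than `α * N` of them have range counts at mean squared distance at
least `κ * (H + 1) ^ (d - 1)`, where `h = d * H`. The whole point set has `O(N)` points, so this is
of order `(log n) ^ (d - 1)`. If the error is `o((log n) ^ (d - 1))`, two weightings for which the
same answer is accurate must then agree on all but `α * N` points. An accurate answer thus reveals
almost all private bits, and `reconstruction_bound` shows that privacy forbids this when `δ < p` and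
`α` is small.

The discrepancy bound (`sum_sq_anchored_ge`) is Roth's method: the signed counting function of
anchored boxes is tested against a sum of tensor Haar functions over many cell shapes of equal
volume. It needs every cell of each shape to hold at most one point, and most points to lie on
plateaus of the integrated Haar functions. The points come from polynomials over `ZMod r` through
their Taylor digits at `d` nodes: Hermite interpolation separates the cells, and equidistribution of
single digits gives the plateaus.

To pass from anchored boxes to all distinct ranges (`avg_boxRanges_ge`), axis points are added which
make a constant fraction of all ranges come from boxes `[-a, b]`, whose trace on the main points
depends on `b` alone. -/

/-! ### Reconstruction against differential privacy -/

/-- Two Boolean vectors explaining a common output are `κ`-close; a private mechanism can then not be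
accurate with probability `p` unless `(N - κ) p ≤ N δ + e^ε (κ + 1)`. -/
theorem reconstruction_bound {J Y : Type*} [Fintype J] [DecidableEq J] [MeasurableSpace Y]
    (μ : (J → Bool) → Measure Y) [∀ w, IsProbabilityMeasure (μ w)] (G : (J → Bool) → Set Y)
    (hG : ∀ w, MeasurableSet (G w)) {p ε δ κ : ℝ} (hκ : 0 ≤ κ)
    (hκN : κ ≤ Fintype.card J)
    (hp : ∀ w, p ≤ (μ w).real (G w))
    (hclose : ∀ w w', (G w ∩ G w').Nonempty →
      ((Finset.univ.filter fun i => w i ≠ w' i).card : ℝ) ≤ κ)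
    (hDP : ∀ w i S, MeasurableSet S →
      (μ w).real S ≤ Real.exp ε * (μ (Function.update w i (!w i))).real S + δ) :
    (Fintype.card J - κ) * p ≤ Fintype.card J * δ + Real.exp ε * (κ + 1) := by
  classical
  -- The decoder picks any vector consistent with `y`. It does not know the true `w`, so the same
  -- events can be compared under neighbouring inputs.
  let dec : Y → J → Bool := fun y => if h : ∃ w, y ∈ G w then h.choose else fun _ => false
  have hdec : ∀ y w, y ∈ G w → y ∈ G (dec y) := by
    intro y w hw
    have h : ∃ w, y ∈ G w := ⟨w, hw⟩
    simp only [dec, dif_pos h]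
    exact h.choose_spec
  -- `dec` factors through the pattern of memberships in the finitely many sets `G w`.
  have hdecm : Measurable dec := by
    let pat : Y → (J → Bool) → Prop := fun y w => y ∈ G w
    have hpat : Measurable pat := measurable_pi_iff.2 fun w => measurable_mem.2 (hG w)
    have hfac : dec = (fun q : (J → Bool) → Prop =>
        if h : ∃ w, q w then h.choose else fun _ => false) ∘ pat := rfl
    rw [hfac]
    exact (measurable_of_countable _).comp hpat
  let A : J → (J → Bool) → Set Y := fun i w => G w ∩ {y | dec y i = w i}
  have hA : ∀ i w, MeasurableSet (A i w) := fun i w =>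
    (hG w).inter ((measurable_pi_apply i).comp hdecm (measurableSet_singleton (w i)))
  have hsum : ∀ (w : J → Bool) (B : J → Set Y), (∀ i, MeasurableSet (B i)) →
      ∑ i, (μ w).real (B i) = ∫ y, ∑ i, (B i).indicator (fun _ => (1 : ℝ)) y ∂(μ w) := by
    intro w B hB
    rw [integral_finsetSum _ fun i _ => (integrable_const (1 : ℝ)).indicator (hB i)]
    exact Finset.sum_congr rfl fun i _ => (integral_indicator_one (hB i)).symm
  have hint : ∀ (w : J → Bool) (B : J → Set Y), (∀ i, MeasurableSet (B i)) →
      Integrable (fun y => ∑ i, (B i).indicator (fun _ => (1 : ℝ)) y) (μ w) := fun w B hB =>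
    integrable_finsetSum _ fun i _ => (integrable_const (1 : ℝ)).indicator (hB i)
  have hsplit : ∀ (v w : J → Bool), ((Finset.univ.filter fun i => v i = w i).card : ℝ)
      + (Finset.univ.filter fun i => v i ≠ w i).card = Fintype.card J := by
    intro v w
    rw [← Finset.card_univ]
    exact_mod_cast Finset.card_filter_add_card_filter_not (s := Finset.univ) fun i => v i = w i
  have lower : ∀ w, (Fintype.card J - κ) * p ≤ ∑ i, (μ w).real (A i w) := by
    intro w
    rw [hsum w (fun i => A i w) fun i => hA i w]
    calc (Fintype.card J - κ) * p ≤ (Fintype.card J - κ) * (μ w).real (G w) :=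
          mul_le_mul_of_nonneg_left (hp w) (sub_nonneg.2 hκN)
      _ = ∫ y, (Fintype.card J - κ) * (G w).indicator (fun _ => (1 : ℝ)) y ∂(μ w) := by
          rw [integral_const_mul]
          exact congrArg _ (integral_indicator_one (hG w)).symm
      _ ≤ _ := by
          refine integral_mono (((integrable_const (1 : ℝ)).indicator (hG w)).const_mul _)
            (hint w (fun i => A i w) fun i => hA i w) fun y => ?_
          by_cases hy : y ∈ G w
          · have h1 : ∑ i, (A i w).indicator (fun _ => (1 : ℝ)) y
                = (Finset.univ.filter fun i => dec y i = w i).card := by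
              rw [Finset.card_filter, Nat.cast_sum]
              refine Finset.sum_congr rfl fun i _ => ?_
              simp [A, Set.indicator_apply, hy]
            have h2 := hclose (dec y) w ⟨y, hdec y w hy, hy⟩
            have h3 := hsplit (dec y) w
            simp only [h1, Set.indicator_of_mem hy, mul_one]
            linarith
          · simp only [Set.indicator_of_notMem hy, mul_zero]
            exact Finset.sum_nonneg fun i _ => Set.indicator_nonneg (fun _ _ => zero_le_one) _
  let fl : J → (J → Bool) → (J → Bool) := fun i w => Function.update w i (!w i)
  have hfl : ∀ i, Function.Involutive (fl i) := by
    intro i w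
    ext k
    by_cases hk : k = i
    · subst hk; simp [fl]
    · simp [fl, hk]
  -- Under input `w`, the event for `i` says that bit `i` is decoded wrongly and that `y` fits `w`
  -- with bit `i` flipped. One such `i₀` already puts `dec y` within `κ + 1` of `w`, which bounds
  -- the number of wrong bits.
  have upper : ∀ w, ∑ i, (μ w).real (A i (fl i w)) ≤ κ + 1 := by
    intro w
    rw [hsum w (fun i => A i (fl i w)) fun i => hA i _]
    calc _ ≤ ∫ _, (κ + 1) ∂(μ w) := by
          refine integral_mono (hint w (fun i => A i (fl i w)) fun i => hA i _)
            (integrable_const _) fun y => ?_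
          by_cases hy : ∃ i, y ∈ A i (fl i w)
          · obtain ⟨i₀, hy₀⟩ := hy
            have h1 : ∑ i, (A i (fl i w)).indicator (fun _ => (1 : ℝ)) y
                ≤ (Finset.univ.filter fun i => dec y i ≠ w i).card := by
              rw [Finset.card_filter, Nat.cast_sum]
              refine Finset.sum_le_sum fun i _ => ?_
              by_cases hi : y ∈ A i (fl i w)
              · have : dec y i ≠ w i := by
                  have := hi.2
                  simp only [fl, Set.mem_ofPred_eq, Function.update_self] at this
                  simp [this]
                simp [hi, this]
              · rw [Set.indicator_of_notMem hi]
                positivity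
            have h2 := hclose (dec y) (fl i₀ w) ⟨y, hdec y _ hy₀.1, hy₀.1⟩
            have h3 : (Finset.univ.filter fun i => dec y i ≠ w i)
                ⊆ insert i₀ (Finset.univ.filter fun i => dec y i ≠ fl i₀ w i) := by
              intro i hi
              by_cases hii : i = i₀
              · simp [hii]
              · simpa [fl, hii] using hi
            have h4 : ((Finset.univ.filter fun i => dec y i ≠ w i).card : ℝ)
                ≤ (Finset.univ.filter fun i => dec y i ≠ fl i₀ w i).card + 1 := by
              exact_mod_cast (Finset.card_le_card h3).trans (Finset.card_insert_le _ _)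
            linarith
          · push Not at hy
            have : ∑ i, (A i (fl i w)).indicator (fun _ => (1 : ℝ)) y = 0 :=
              Finset.sum_eq_zero fun i _ => Set.indicator_of_notMem (hy i) _
            simp only [this]
            linarith
      _ = κ + 1 := by simp
  have key : ∑ w : J → Bool, ∑ i, (μ w).real (A i w)
      ≤ ∑ w : J → Bool, (Fintype.card J * δ + Real.exp ε * (κ + 1)) := by
    calc _ ≤ ∑ w : J → Bool, ∑ i, (Real.exp ε * (μ (fl i w)).real (A i w) + δ) :=
          Finset.sum_le_sum fun w _ => Finset.sum_le_sum fun i _ => hDP w i _ (hA i w)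
      _ = ∑ w : J → Bool, Fintype.card J * δ
          + Real.exp ε * ∑ i, ∑ w : J → Bool, (μ (fl i w)).real (A i w) := by
          rw [Finset.sum_comm (s := (Finset.univ : Finset J)), Finset.mul_sum,
            ← Finset.sum_add_distrib]
          refine Finset.sum_congr rfl fun w _ => ?_
          rw [Finset.sum_add_distrib, Finset.mul_sum]
          simp [add_comm]
      _ = ∑ w : J → Bool, Fintype.card J * δ
          + Real.exp ε * ∑ w : J → Bool, ∑ i, (μ w).real (A i (fl i w)) := by
          -- Averaging over all inputs makes the flip `w ↦ fl i w` a change of variables.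
          rw [Finset.sum_comm (t := (Finset.univ : Finset J))]
          congr 2
          refine Finset.sum_congr rfl fun i _ => ?_
          refine Fintype.sum_equiv ((hfl i).toPerm (fl i)) _ _ fun w => ?_
          change _ = (μ (fl i w)).real (A i (fl i (fl i w)))
          rw [hfl i w]
      _ ≤ _ := by
          rw [Finset.sum_add_distrib, ← Finset.mul_sum Finset.univ fun _ => κ + 1]
          have := Finset.sum_le_sum fun w (_ : w ∈ (Finset.univ : Finset (J → Bool))) => upper w
          gcongr
  by_contra hcon
  push Not at hcon
  refine absurd key (not_le.2 ?_)
  exact Finset.sum_lt_sum_of_nonempty Finset.univ_nonempty fun w _ => hcon.trans_le (lower w)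

/-! ### One-dimensional `p`-adic Haar functions -/

/-- The sign attached to a base-`p` digit: `-1` on the first digit, `1` on the last one. -/
noncomputable def digitSign (p a : ℕ) : ℝ := if a = 0 then -1 else if a = p - 1 then 1 else 0

theorem digitSign_sq_le_one (p a : ℕ) : digitSign p a ^ 2 ≤ 1 := by
  unfold digitSign; split_ifs <;> norm_num

/-- The tail sum, within a block of length `p * M`, of the sign of the leading digit. -/
noncomputable def haarTail (p M u : ℕ) : ℝ := ∑ v ∈ Finset.Ico u (p * M), digitSign p (v / M)

/-- The zero middle digits give the tail sum a plateau, occupying all but a `2 / p` share of the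
block. -/
theorem haarTail_of_middle {p M u : ℕ} (hp : 2 ≤ p) (hM : 0 < M) (h0 : M ≤ u)
    (h1 : u ≤ (p - 1) * M) : haarTail p M u = M := by
  have hpM : p * M = (p - 1) * M + M := by
    obtain ⟨q, rfl⟩ : ∃ q, p = q + 1 := ⟨p - 1, by omega⟩
    simp [add_mul]
  unfold haarTail
  rw [← Finset.sum_Ico_consecutive _ h1 (by omega : (p - 1) * M ≤ p * M)]
  have e1 : ∑ v ∈ Finset.Ico u ((p - 1) * M), digitSign p (v / M) = 0 := by
    refine Finset.sum_eq_zero fun v hv => ?_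
    rw [Finset.mem_Ico] at hv
    have a1 : 1 ≤ v / M := (Nat.le_div_iff_mul_le hM).2 (by omega)
    have a2 : v / M < p - 1 := (Nat.div_lt_iff_lt_mul hM).2 hv.2
    unfold digitSign
    rw [if_neg (by omega), if_neg (by omega)]
  have e2 : ∀ v ∈ Finset.Ico ((p - 1) * M) (p * M), digitSign p (v / M) = 1 := by
    intro v hv
    rw [Finset.mem_Ico] at hv
    have a1 : p - 1 ≤ v / M := (Nat.le_div_iff_mul_le hM).2 hv.1
    have a2 : v / M < p := (Nat.div_lt_iff_lt_mul hM).2 hv.2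
    unfold digitSign
    rw [if_neg (by omega), if_pos (by omega)]
  rw [e1, Finset.sum_congr rfl e2]
  simp [hpM]

theorem haarTail_of_first {p M u : ℕ} (hp : 2 ≤ p) (hM : 0 < M) (h0 : u ≤ M) :
    haarTail p M u = u := by
  have hpM : M ≤ p * M := Nat.le_mul_of_pos_left _ (by omega)
  have hm : haarTail p M M = M :=
    haarTail_of_middle hp hM le_rfl (Nat.le_mul_of_pos_left _ (by omega))
  unfold haarTail at hm ⊢
  rw [← Finset.sum_Ico_consecutive _ h0 hpM, hm]
  have e2 : ∀ v ∈ Finset.Ico u M, digitSign p (v / M) = -1 := by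
    intro v hv
    rw [Finset.mem_Ico] at hv
    rw [Nat.div_eq_of_lt hv.2]
    simp [digitSign]
  rw [Finset.sum_congr rfl e2]
  simp [Nat.cast_sub h0]

/-- With this, points off the plateau can be discarded from lower bounds. -/
theorem haarTail_nonneg {p M u : ℕ} (hp : 2 ≤ p) (hM : 0 < M) : 0 ≤ haarTail p M u := by
  rcases le_total u M with h | h
  · rw [haarTail_of_first hp hM h]; positivity
  rcases le_total u ((p - 1) * M) with h' | h'
  · rw [haarTail_of_middle hp hM h h']; positivity
  refine Finset.sum_nonneg fun v hv => ?_
  rw [Finset.mem_Ico] at hv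
  have a1 : p - 1 ≤ v / M := (Nat.le_div_iff_mul_le hM).2 (h'.trans hv.1)
  have a2 : v / M < p := (Nat.div_lt_iff_lt_mul hM).2 hv.2
  unfold digitSign
  rw [if_neg (by omega), if_pos (by omega)]
  exact zero_le_one

theorem sum_range_mul_eq (N L : ℕ) (F : ℕ → ℝ) :
    ∑ t ∈ Finset.range (N * L), F t
      = ∑ i ∈ Finset.range N, ∑ u ∈ Finset.range L, F (i * L + u) := by
  induction N with
  | zero => simp
  | succ N ih => rw [add_mul, one_mul, Finset.sum_range_add, ih, Finset.sum_range_succ]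

/-- Summation of a block function against the digit sign above a threshold `q`. -/
theorem sum_digitSign_mul {p m N q : ℕ} (hp : 2 ≤ p) (hq : q < N * (p * p ^ m)) (g : ℕ → ℝ) :
    ∑ t ∈ Finset.range (N * (p * p ^ m)),
      (if q ≤ t then digitSign p (t / p ^ m % p) * g (t / (p * p ^ m)) else 0)
      = g (q / (p * p ^ m)) * haarTail p (p ^ m) (q % (p * p ^ m)) := by
  have hM : 0 < p ^ m := pow_pos (by omega) m
  set M := p ^ m with hMdef
  have hL : 0 < p * M := Nat.mul_pos (by omega) hM
  have hdig : ∀ i u, u < p * M → (i * (p * M) + u) / M % p = u / M := by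
    intro i u hu
    rw [show i * (p * M) + u = u + M * (i * p) by ring, Nat.add_mul_div_left _ _ hM,
      Nat.add_mul_mod_self_right, Nat.mod_eq_of_lt ((Nat.div_lt_iff_lt_mul hM).2 hu)]
  have hblk : ∀ i u, u < p * M → (i * (p * M) + u) / (p * M) = i := by
    intro i u hu
    rw [show i * (p * M) + u = u + (p * M) * i by ring, Nat.add_mul_div_left _ _ hL,
      Nat.div_eq_of_lt hu, zero_add]
  have hqe : q / (p * M) * (p * M) + q % (p * M) = q := Nat.div_add_mod' q (p * M)
  have hqm : q % (p * M) < p * M := Nat.mod_lt _ hL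
  -- Blocks below that of `q` are cut off and blocks above it cancel, since the signs in a full
  -- block sum to zero.
  rw [sum_range_mul_eq, Finset.sum_eq_single (q / (p * M))]
  · unfold haarTail
    rw [Finset.mul_sum, ← Finset.sum_filter]
    refine Finset.sum_congr ?_ fun u hu => ?_
    · ext u
      simp only [Finset.mem_filter, Finset.mem_range, Finset.mem_Ico]
      constructor
      · rintro ⟨h1, h2⟩; exact ⟨by omega, h1⟩
      · rintro ⟨h1, h2⟩; exact ⟨h2, by omega⟩
    · have hu' := (Finset.mem_Ico.1 hu).2
      rw [hdig _ _ hu', hblk _ _ hu', mul_comm]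
  · intro i hi hne
    rcases lt_or_gt_of_ne hne with h | h
    · refine Finset.sum_eq_zero fun u hu => if_neg ?_
      have := Finset.mem_range.1 hu
      have h2 : (i + 1) * (p * M) ≤ q / (p * M) * (p * M) := Nat.mul_le_mul_right _ h
      rw [add_mul, one_mul] at h2
      omega
    · have e : ∀ u ∈ Finset.range (p * M), (if q ≤ i * (p * M) + u then
          digitSign p ((i * (p * M) + u) / M % p) * g ((i * (p * M) + u) / (p * M)) else 0)
          = digitSign p (u / M) * g i := by
        intro u hu
        have hu' := Finset.mem_range.1 hu
        have h2 : (q / (p * M) + 1) * (p * M) ≤ i * (p * M) := Nat.mul_le_mul_right _ h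
        rw [add_mul, one_mul] at h2
        rw [if_pos (by omega), hdig _ _ hu', hblk _ _ hu']
      rw [Finset.sum_congr rfl e, ← Finset.sum_mul]
      have h0 := haarTail_of_first (u := 0) hp hM (Nat.zero_le _)
      unfold haarTail at h0
      rw [Nat.Ico_zero_eq_range] at h0
      rw [h0]
      simp
  · intro h
    exact absurd (Finset.mem_range.2 ((Nat.div_lt_iff_lt_mul hL).2 hq)) h

/-- The `p`-adic Haar-type function on the `i`-th block of length `p ^ (m + 1)`. -/
noncomputable def haarFn (p m i t : ℕ) : ℝ :=
  digitSign p (t / p ^ m % p) * if t / (p * p ^ m) = i then 1 else 0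

theorem sum_haarFn_Ici {p m h q : ℕ} (i : ℕ) (hp : 2 ≤ p) (hm : m ≤ h) (hq : q < p ^ (h + 1)) :
    ∑ t ∈ Finset.range (p ^ (h + 1)), (if q ≤ t then haarFn p m i t else 0)
      = (if q / (p * p ^ m) = i then 1 else 0) * haarTail p (p ^ m) (q % (p * p ^ m)) := by
  have e : p ^ (h + 1) = p ^ (h - m) * (p * p ^ m) := by
    rw [← pow_succ', ← pow_add]; congr 1; omega
  rw [e] at hq ⊢
  exact sum_digitSign_mul hp hq fun s => if s = i then (1 : ℝ) else 0

/-- The coarser function is constant on each block of the finer one, where the finer one sums to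
zero. -/
theorem sum_haarFn_mul_of_lt {p m m' h : ℕ} (i i' : ℕ) (hp : 2 ≤ p) (hmm : m < m') (hm : m' ≤ h) :
    ∑ t ∈ Finset.range (p ^ (h + 1)), haarFn p m i t * haarFn p m' i' t = 0 := by
  have e : p ^ (h + 1) = p ^ (h - m) * (p * p ^ m) := by
    rw [← pow_succ', ← pow_add]; congr 1; omega
  have hpos : 0 < p ^ (h + 1) := pow_pos (by omega) _
  -- The coarser function is written in terms of the index `s` of the finer block; at threshold `0`
  -- the tail vanishes.
  have key := sum_digitSign_mul (q := 0) (m := m) (N := p ^ (h - m)) hp (by rw [← e]; exact hpos)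
    fun s => (if s = i then (1 : ℝ) else 0) * (digitSign p (s / p ^ (m' - (m + 1)) % p) *
      if s / p ^ (m' - m) = i' then 1 else 0)
  rw [Nat.zero_mod, haarTail_of_first hp (pow_pos (by omega) m) (Nat.zero_le _), Nat.cast_zero,
    mul_zero, ← e] at key
  rw [← key]
  refine Finset.sum_congr rfl fun t _ => ?_
  rw [if_pos (Nat.zero_le _)]
  unfold haarFn
  rw [Nat.div_div_eq_div_mul, Nat.div_div_eq_div_mul]
  have e1 : p * p ^ m * p ^ (m' - (m + 1)) = p ^ m' := by
    rw [← pow_succ', ← pow_add]; congr 1; omega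
  have e2 : p * p ^ m * p ^ (m' - m) = p * p ^ m' := by
    rw [mul_assoc, ← pow_add]; congr 2; omega
  rw [e1, e2]
  ring

theorem sum_haarFn_mul_of_ne {p m m' h : ℕ} (i i' : ℕ) (hp : 2 ≤ p) (hmm : m ≠ m') (hm : m ≤ h)
    (hm' : m' ≤ h) :
    ∑ t ∈ Finset.range (p ^ (h + 1)), haarFn p m i t * haarFn p m' i' t = 0 := by
  rcases lt_or_gt_of_ne hmm with h1 | h1
  · exact sum_haarFn_mul_of_lt i i' hp h1 hm'
  · simp only [mul_comm (haarFn p m i _)]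
    exact sum_haarFn_mul_of_lt i' i hp h1 hm

theorem haarFn_mul_of_ne {p m i i' : ℕ} (hi : i ≠ i') (t : ℕ) :
    haarFn p m i t * haarFn p m i' t = 0 := by
  unfold haarFn
  by_cases h : t / (p * p ^ m) = i
  · rw [if_neg (fun h' => hi (h.symm.trans h') : ¬ t / (p * p ^ m) = i')]; simp
  · rw [if_neg h]; simp

theorem sum_haarFn_sq_le {p m : ℕ} (i n : ℕ) (hp : 2 ≤ p) :
    ∑ t ∈ Finset.range n, haarFn p m i t * haarFn p m i t ≤ (p : ℝ) * p ^ m := by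
  have hL : 0 < p * p ^ m := Nat.mul_pos (by omega) (pow_pos (by omega) m)
  calc _ ≤ ∑ t ∈ Finset.range n, if t / (p * p ^ m) = i then (1 : ℝ) else 0 := by
        refine Finset.sum_le_sum fun t _ => ?_
        unfold haarFn
        have := digitSign_sq_le_one p (t / p ^ m % p)
        split_ifs
        · nlinarith
        · simp
    _ = ((Finset.range n).filter fun t => t / (p * p ^ m) = i).card := by simp
    _ ≤ ((Finset.Ico (i * (p * p ^ m)) ((i + 1) * (p * p ^ m))).card : ℝ) := by
        refine Nat.cast_le.2 (Finset.card_le_card fun t ht => ?_)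
        rw [Finset.mem_filter] at ht
        rw [Finset.mem_Ico, ← Nat.le_div_iff_mul_le hL, ← Nat.div_lt_iff_lt_mul hL, ht.2]
        omega
    _ = _ := by simp [add_mul]

theorem sum_mul_bilinear {ι X Y : Type*} (B : Finset ι) (s : Finset X) (t : Finset Y) (u : X → ℝ)
    (v : Y → ℝ) (f : X → ι → ℝ) (g : Y → ι → ℝ) :
    ∑ b ∈ B, (∑ x ∈ s, u x * f x b) * (∑ y ∈ t, v y * g y b)
      = ∑ x ∈ s, ∑ y ∈ t, u x * v y * ∑ b ∈ B, f x b * g y b := by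
  simp_rw [Finset.sum_mul_sum, Finset.mul_sum]
  rw [Finset.sum_comm]
  refine Finset.sum_congr rfl fun x _ => ?_
  rw [Finset.sum_comm]
  exact Finset.sum_congr rfl fun y _ => Finset.sum_congr rfl fun b _ => by ring

/-! ### Tensor Haar functions and Roth's method -/

/-- The grid `{0, …, n - 1}^d`. -/
def gridBox (d n : ℕ) : Finset (Fin d → ℕ) := Fintype.piFinset fun _ => Finset.range n

theorem sum_gridBox_prod {d n : ℕ} (F : Fin d → ℕ → ℝ) :
    ∑ b ∈ gridBox d n, ∏ k, F k (b k) = ∏ k, ∑ t ∈ Finset.range n, F k t :=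
  (Finset.prod_univ_sum (fun _ => Finset.range n) F).symm

/-- The tensor-product Haar function of shape `m` on the cell containing `q`. -/
noncomputable def boxHaar {d : ℕ} (p : ℕ) (m q b : Fin d → ℕ) : ℝ :=
  ∏ k, haarFn p (m k) (q k / (p * p ^ m k)) (b k)

section
variable {d p h : ℕ} {m m' q q' : Fin d → ℕ}

theorem sum_boxHaar_mul_eq_zero (hp : 2 ≤ p) (hm : ∀ k, m k ≤ h) (hm' : ∀ k, m' k ≤ h)
    (hne : m = m' → ∃ k, q k / (p * p ^ m k) ≠ q' k / (p * p ^ m k)) :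
    ∑ b ∈ gridBox d (p ^ (h + 1)), boxHaar p m q b * boxHaar p m' q' b = 0 := by
  unfold boxHaar
  simp only [← Finset.prod_mul_distrib]
  rw [sum_gridBox_prod fun k t => haarFn p (m k) (q k / (p * p ^ m k)) t *
    haarFn p (m' k) (q' k / (p * p ^ m' k)) t]
  by_cases hmm : m = m'
  · subst hmm
    obtain ⟨k, hk⟩ := hne rfl
    exact Finset.prod_eq_zero (Finset.mem_univ k)
      (Finset.sum_eq_zero fun t _ => haarFn_mul_of_ne hk t)
  · obtain ⟨k, hk⟩ := Function.ne_iff.1 hmm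
    exact Finset.prod_eq_zero (Finset.mem_univ k)
      (sum_haarFn_mul_of_ne _ _ hp hk (hm k) (hm' k))

theorem sum_boxHaar_sq_le (hp : 2 ≤ p) (n : ℕ) :
    ∑ b ∈ gridBox d n, boxHaar p m q b * boxHaar p m q b ≤ (p : ℝ) ^ d * p ^ ∑ k, m k := by
  unfold boxHaar
  simp only [← Finset.prod_mul_distrib]
  rw [sum_gridBox_prod fun k t => haarFn p (m k) (q k / (p * p ^ m k)) t *
    haarFn p (m k) (q k / (p * p ^ m k)) t]
  calc _ ≤ ∏ k, (p : ℝ) * p ^ m k := Finset.prod_le_prod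
        (fun k _ => Finset.sum_nonneg fun t _ => mul_self_nonneg _)
        fun k _ => sum_haarFn_sq_le _ _ hp
    _ = _ := by simp [Finset.prod_mul_distrib, Finset.prod_pow_eq_pow_sum]

-- The sum vanishes unless `q'` lies in the cell of `q`, so pairing with an anchored box detects
-- only points of that cell.
open Classical in
theorem sum_boxHaar_Ici (hp : 2 ≤ p) (hm : ∀ k, m k ≤ h) (hq' : ∀ k, q' k < p ^ (h + 1)) :
    ∑ b ∈ gridBox d (p ^ (h + 1)), (if q' ≤ b then boxHaar p m q b else 0)
      = ∏ k, (if q' k / (p * p ^ m k) = q k / (p * p ^ m k) then 1 else 0) *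
          haarTail p (p ^ m k) (q' k % (p * p ^ m k)) := by
  have e : ∀ b : Fin d → ℕ, (if q' ≤ b then boxHaar p m q b else 0)
      = ∏ k, if q' k ≤ b k then haarFn p (m k) (q k / (p * p ^ m k)) (b k) else 0 := by
    intro b
    by_cases hb : q' ≤ b
    · rw [if_pos hb]
      exact Finset.prod_congr rfl fun k _ => (if_pos (hb k)).symm
    · rw [if_neg hb]
      obtain ⟨k, hk⟩ : ∃ k, ¬ q' k ≤ b k := by simpa [Pi.le_def] using hb
      exact (Finset.prod_eq_zero (Finset.mem_univ k) (if_neg hk)).symm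
  simp only [e]
  rw [sum_gridBox_prod fun k t => if q' k ≤ t then haarFn p (m k) (q k / (p * p ^ m k)) t else 0]
  exact Finset.prod_congr rfl fun k _ => sum_haarFn_Ici _ hp (hm k) (hq' k)

end

/-- A base-`p` digit that is neither the first nor the last one. -/
def IsMiddle (p a : ℕ) : Prop := a ≠ 0 ∧ a ≠ p - 1

theorem haarTail_of_isMiddle {p m t : ℕ} (hp : 2 ≤ p) (hd : IsMiddle p (t / p ^ m % p)) :
    haarTail p (p ^ m) (t % (p * p ^ m)) = (p : ℝ) ^ m := by
  have hM : 0 < p ^ m := pow_pos (by omega) m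
  have e : t % (p * p ^ m) / p ^ m = t / p ^ m % p := by
    rw [mul_comm, Nat.mod_mul_right_div_self]
  have hlt : t / p ^ m % p < p := Nat.mod_lt _ (by omega)
  obtain ⟨h0, h1⟩ := hd
  rw [haarTail_of_middle hp hM, Nat.cast_pow]
  · have := (Nat.le_div_iff_mul_le hM (x := 1) (y := t % (p * p ^ m))).1 (by omega)
    omega
  · exact ((Nat.div_lt_iff_lt_mul hM).1 (by omega)).le

open Classical in
/-- Roth's orthogonal function method for signed sums over anchored boxes. -/
theorem sum_sq_anchored_ge {J : Type*} [Fintype J] {d p h : ℕ} (hp : 2 ≤ p) (c : J → Fin d → ℕ)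
    (hc : ∀ j k, c j k < p ^ (h + 1)) (S : Finset (Fin d → ℕ)) (hS : ∀ m ∈ S, ∀ k, m k ≤ h)
    (hinj : ∀ m ∈ S, ∀ j j', (∀ k, c j k / (p * p ^ m k) = c j' k / (p * p ^ m k)) → j = j')
    (hvol : ∀ m ∈ S, (Fintype.card J : ℝ) * p ^ ∑ k, m k = (p : ℝ) ^ (d * h))
    (z : J → ℝ) (hz : ∀ j, z j = 0 ∨ z j ^ 2 = 1) {γ : ℝ} (hγ : 0 ≤ γ)
    (hgood : ∀ m ∈ S, γ * Fintype.card J ≤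
      (Finset.univ.filter fun j => z j ≠ 0 ∧ ∀ k, IsMiddle p (c j k / p ^ m k % p)).card) :
    S.card * γ ^ 2 * (p : ℝ) ^ (d * h) ≤
      p ^ d * ∑ b ∈ gridBox d (p ^ (h + 1)), (∑ j, if c j ≤ b then z j else 0) ^ 2 := by
  set B := gridBox d (p ^ (h + 1)) with hB
  let D : (Fin d → ℕ) → ℝ := fun b => ∑ j, if c j ≤ b then z j else 0
  -- The test function: each point's Haar function carries the point's own sign, so the diagonal
  -- terms are squares.
  let F : (Fin d → ℕ) → ℝ := fun b => ∑ m ∈ S, ∑ j, z j * boxHaar p m (c j) b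
  have hp0 : (0 : ℝ) < p := by positivity
  have hpM : ∀ m, 0 < p ^ m := fun m => pow_pos (by omega) m
  -- Distinct points lie in distinct cells and distinct shapes are orthogonal, so only diagonal
  -- terms remain.
  have hFF : ∑ b ∈ B, F b ^ 2 ≤ S.card * ((p : ℝ) ^ d * p ^ (d * h)) := by
    have e1 : ∑ b ∈ B, F b ^ 2 = ∑ m ∈ S, ∑ j, ∑ m' ∈ S, ∑ j',
        z j * z j' * ∑ b ∈ B, boxHaar p m (c j) b * boxHaar p m' (c j') b := by
      have := sum_mul_bilinear B (S ×ˢ Finset.univ) (S ×ˢ Finset.univ) (fun x => z x.2)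
        (fun x => z x.2) (fun x => boxHaar p x.1 (c x.2)) fun x => boxHaar p x.1 (c x.2)
      simpa only [Finset.sum_product, ← sq] using this
    have e2 : ∀ m ∈ S, ∀ j, ∑ m' ∈ S, ∑ j',
        z j * z j' * ∑ b ∈ B, boxHaar p m (c j) b * boxHaar p m' (c j') b
        = z j * z j * ∑ b ∈ B, boxHaar p m (c j) b * boxHaar p m (c j) b := by
      intro m hm j
      rw [Finset.sum_eq_single m, Finset.sum_eq_single j]
      · intro j' _ hj
        rw [hB, sum_boxHaar_mul_eq_zero hp (hS m hm) (hS m hm), mul_zero]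
        intro _
        by_contra hcon
        push Not at hcon
        exact hj (hinj m hm j j' hcon).symm
      · simp
      · intro m' hm' hne
        refine Finset.sum_eq_zero fun j' _ => ?_
        rw [hB, sum_boxHaar_mul_eq_zero hp (hS m hm) (hS m' hm') fun h => absurd h.symm hne,
          mul_zero]
      · exact fun h => absurd hm h
    rw [e1]
    calc _ = ∑ m ∈ S, ∑ j, z j * z j * ∑ b ∈ B, boxHaar p m (c j) b * boxHaar p m (c j) b :=
          Finset.sum_congr rfl fun m hm => Finset.sum_congr rfl fun j _ => e2 m hm j
      _ ≤ ∑ m ∈ S, ∑ j : J, 1 * ((p : ℝ) ^ d * p ^ ∑ k, m k) := by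
          refine Finset.sum_le_sum fun m _ => Finset.sum_le_sum fun j _ => ?_
          refine mul_le_mul ?_ (sum_boxHaar_sq_le hp _)
            (Finset.sum_nonneg fun b _ => mul_self_nonneg _) zero_le_one
          rcases hz j with h | h
          · simp [h]
          · rw [← sq, h]
      _ = ∑ m ∈ S, ((p : ℝ) ^ d * p ^ (d * h)) := by
          refine Finset.sum_congr rfl fun m hm => ?_
          rw [← hvol m hm, Finset.sum_const, Finset.card_univ, nsmul_eq_mul]
          ring
      _ = _ := by rw [Finset.sum_const, nsmul_eq_mul]
  -- For each shape a point pairs only with its own cell. The resulting terms are nonnegative, and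
  -- points with all digits in the middle contribute the full `p ^ ∑ k, m k`.
  have hDF : S.card * (γ * (p : ℝ) ^ (d * h)) ≤ ∑ b ∈ B, D b * F b := by
    have e1 : ∑ b ∈ B, D b * F b = ∑ m ∈ S, ∑ j', ∑ j, z j' * z j *
        ∑ b ∈ B, if c j' ≤ b then boxHaar p m (c j) b else 0 := by
      have := sum_mul_bilinear B Finset.univ (S ×ˢ Finset.univ) z (fun x => z x.2)
        (fun j b => if c j ≤ b then 1 else 0) fun x => boxHaar p x.1 (c x.2)
      simp only [Finset.sum_product, mul_ite, mul_one, mul_zero, ite_mul, one_mul, zero_mul] at this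
      rw [Finset.sum_comm]
      simpa only [D, F, mul_ite, mul_zero] using this
    have e2 : ∀ m ∈ S, ∀ j', ∑ j, z j' * z j *
        ∑ b ∈ B, (if c j' ≤ b then boxHaar p m (c j) b else 0)
        = z j' ^ 2 * ∏ k, haarTail p (p ^ m k) (c j' k % (p * p ^ m k)) := by
      intro m hm j'
      rw [Finset.sum_eq_single j']
      · rw [hB, sum_boxHaar_Ici hp (hS m hm) (hc j'), sq]
        simp
      · intro j _ hj
        obtain ⟨k, hk⟩ : ∃ k, ¬ c j' k / (p * p ^ m k) = c j k / (p * p ^ m k) := by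
          by_contra hcon
          push Not at hcon
          exact hj (hinj m hm j' j hcon).symm
        rw [hB, sum_boxHaar_Ici hp (hS m hm) (hc j'), Finset.prod_eq_zero (Finset.mem_univ k),
          mul_zero]
        rw [if_neg hk, zero_mul]
      · simp
    rw [e1, ← nsmul_eq_mul]
    refine Finset.card_nsmul_le_sum _ _ _ fun m hm => ?_
    rw [Finset.sum_congr rfl fun j' _ => e2 m hm j', ← hvol m hm, ← mul_assoc]
    calc _ ≤ ((Finset.univ.filter fun j =>
          z j ≠ 0 ∧ ∀ k, IsMiddle p (c j k / p ^ m k % p)).card : ℝ) * p ^ ∑ k, m k := by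
          gcongr
          exact hgood m hm
      _ = ∑ j ∈ Finset.univ.filter fun j => z j ≠ 0 ∧ ∀ k, IsMiddle p (c j k / p ^ m k % p),
          (p : ℝ) ^ ∑ k, m k := by rw [Finset.sum_const, nsmul_eq_mul]
      _ ≤ ∑ j ∈ Finset.univ.filter fun j => z j ≠ 0 ∧ ∀ k, IsMiddle p (c j k / p ^ m k % p),
          z j ^ 2 * ∏ k, haarTail p (p ^ m k) (c j k % (p * p ^ m k)) := by
          refine Finset.sum_le_sum fun j hj => le_of_eq ?_
          obtain ⟨-, h0, hmid⟩ := Finset.mem_filter.1 hj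
          rw [(hz j).resolve_left h0, one_mul, ← Finset.prod_pow_eq_pow_sum]
          exact Finset.prod_congr rfl fun k _ => (haarTail_of_isMiddle hp (hmid k)).symm
      _ ≤ _ := Finset.sum_le_univ_sum_of_nonneg fun j => mul_nonneg (sq_nonneg _)
          (Finset.prod_nonneg fun k _ => haarTail_nonneg hp (hpM _))
  rcases S.eq_empty_or_nonempty with rfl | hSne
  · simp only [Finset.card_empty, Nat.cast_zero, zero_mul]
    positivity
  have hS0 : (0 : ℝ) < S.card := by exact_mod_cast hSne.card_pos
  have hCS := Finset.sum_mul_sq_le_sq_mul_sq B D F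
  have hX : (0 : ℝ) < p ^ (d * h) := by positivity
  have hDD : 0 ≤ ∑ b ∈ B, D b ^ 2 := Finset.sum_nonneg fun b _ => sq_nonneg _
  have h1 : (S.card * (γ * (p : ℝ) ^ (d * h))) ^ 2
      ≤ (∑ b ∈ B, D b ^ 2) * (S.card * ((p : ℝ) ^ d * p ^ (d * h))) :=
    (pow_le_pow_left₀ (by positivity) hDF 2).trans
      (hCS.trans (mul_le_mul_of_nonneg_left hFF hDD))
  have h2 : (S.card * (p : ℝ) ^ (d * h)) * (S.card * γ ^ 2 * (p : ℝ) ^ (d * h))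
      ≤ (S.card * (p : ℝ) ^ (d * h)) * (p ^ d * ∑ b ∈ B, D b ^ 2) := by
    linarith
  exact le_of_mul_le_mul_left h2 (by positivity)

/-! ### Hermite interpolation and the digital point set -/

section
variable {F : Type*} [Field F] {h : ℕ}

/-- The polynomial of degree less than `h` with given coefficients. -/
noncomputable def polyOfCoeffs (F : Type*) [Field F] (h : ℕ) : (Fin h → F) →ₗ[F] Polynomial F :=
  (Polynomial.degreeLT F h).subtype ∘ₗ (Polynomial.degreeLTEquiv F h).symm.toLinearMap

theorem polyOfCoeffs_injective : Function.Injective (polyOfCoeffs F h) :=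
  Subtype.val_injective.comp (Polynomial.degreeLTEquiv F h).symm.injective

theorem degree_polyOfCoeffs_lt (v : Fin h → F) : (polyOfCoeffs F h v).degree < h :=
  Polynomial.mem_degreeLT.1 ((Polynomial.degreeLTEquiv F h).symm v).2

theorem exists_polyOfCoeffs_eq {f : Polynomial F} (hf : f.degree < h) :
    ∃ v, polyOfCoeffs F h v = f :=
  ⟨Polynomial.degreeLTEquiv F h ⟨f, Polynomial.mem_degreeLT.2 hf⟩, by simp [polyOfCoeffs]⟩

/-- The `s`-th Taylor coefficient at `a`, as a functional on coefficient vectors. -/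
noncomputable def taylorFunctional (h : ℕ) (a : F) (s : ℕ) : (Fin h → F) →ₗ[F] F :=
  Polynomial.lcoeff F s ∘ₗ Polynomial.taylor a ∘ₗ polyOfCoeffs F h

theorem taylorFunctional_apply (a : F) (s : ℕ) (v : Fin h → F) :
    taylorFunctional h a s v = (Polynomial.taylor a (polyOfCoeffs F h v)).coeff s := rfl

theorem exists_taylorFunctional_eq_one (a : F) {s : ℕ} (hs : s < h) :
    ∃ v, taylorFunctional h a s v = 1 := by
  obtain ⟨v, hv⟩ := exists_polyOfCoeffs_eq (F := F) (h := h)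
    (f := (Polynomial.X - Polynomial.C a) ^ s) (by simpa using hs)
  exact ⟨v, by simp [taylorFunctional_apply, hv, Polynomial.taylor_apply]⟩

theorem taylorFunctional_degree_eq_zero (a : F) (v : Fin h → F) : taylorFunctional h a h v = 0 := by
  rw [taylorFunctional_apply]
  refine Polynomial.coeff_eq_zero_of_degree_lt ?_
  rw [Polynomial.degree_taylor]
  exact degree_polyOfCoeffs_lt v

/-- Uniqueness in Hermite interpolation. -/
theorem eq_of_taylorFunctional_eq {d : ℕ} {a : Fin d → F} (ha : Function.Injective a)
    {r : Fin d → ℕ} (hr : h ≤ ∑ k, r k) {v w : Fin h → F}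
    (hvw : ∀ k, ∀ s < r k, taylorFunctional h (a k) s v = taylorFunctional h (a k) s w) : v = w := by
  rw [← sub_eq_zero]
  apply polyOfCoeffs_injective
  rw [map_zero]
  have hdvd : ∏ k, (Polynomial.X - Polynomial.C (a k)) ^ r k ∣ polyOfCoeffs F h (v - w) := by
    refine Finset.prod_dvd_of_coprime (fun k _ l _ hkl => ?_) fun k _ => ?_
    · exact (Polynomial.pairwise_coprime_X_sub_C ha hkl).pow
    · rw [Polynomial.X_sub_C_pow_dvd_iff, Polynomial.X_pow_dvd_iff]
      intro s hs
      rw [← Polynomial.taylor_apply, ← taylorFunctional_apply, map_sub, hvw k s hs, sub_self]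
  refine Polynomial.eq_zero_of_dvd_of_degree_lt hdvd ((degree_polyOfCoeffs_lt _).trans_le ?_)
  rw [Polynomial.degree_prod]
  simp only [Polynomial.degree_pow, Polynomial.degree_X_sub_C, nsmul_eq_mul, mul_one]
  exact_mod_cast hr

-- The translates of a fibre by multiples of a vector on which the functional is `1` are disjoint.
open Classical in
theorem card_taylorFunctional_fiber_mul_le [Fintype F] (a c : F) {s : ℕ} (hs : s < h) :
    (Finset.univ.filter fun v => taylorFunctional h a s v = c).card * Fintype.card F
      ≤ Fintype.card (Fin h → F) := by
  obtain ⟨u, hu⟩ := exists_taylorFunctional_eq_one (h := h) a hs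
  rw [← Finset.card_univ (α := F), ← Finset.card_product, ← Finset.card_univ]
  refine Finset.card_le_card_of_injOn (fun x => x.1 + x.2 • u) (fun _ _ => Finset.mem_univ _) ?_
  rintro ⟨v, x⟩ hv ⟨w, y⟩ hw e
  simp only [Finset.coe_product, Finset.coe_filter, Set.mem_prod, Set.mem_ofPred_eq,
    Finset.mem_univ, true_and, Finset.coe_univ, Set.mem_univ, and_true] at hv hw
  simp only at e
  have e' := congrArg (taylorFunctional h a s) e
  simp only [map_add, map_smul, hv, hw, hu, smul_eq_mul, mul_one, add_right_inj] at e'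
  subst e'
  rw [add_right_cancel e]

end

/-- Points with prescribed base-`p` digits: the digit at place `i` of the `k`-th coordinate of the
point of `v` is one more than the Taylor coefficient of order `h - i` at `k`. -/
noncomputable def hermitePoint (d p h : ℕ) [Fact p.Prime] (v : Fin h → ZMod p)
    (k : Fin d) : ℕ :=
  (finFunctionFinEquiv fun i : Fin (h + 1) =>
    (⟨(taylorFunctional h ((k : ℕ) : ZMod p) (h - i) v + 1).val, ZMod.val_lt _⟩ : Fin p) : ℕ)

section
variable {d p h : ℕ} [Fact p.Prime]

theorem hermitePoint_lt (v : Fin h → ZMod p) (k : Fin d) :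
    hermitePoint d p h v k < p ^ (h + 1) := Fin.is_lt _

theorem hermitePoint_digit (v : Fin h → ZMod p) (k : Fin d) {i : ℕ} (hi : i ≤ h) :
    hermitePoint d p h v k / p ^ i % p
      = (taylorFunctional h ((k : ℕ) : ZMod p) (h - i) v + 1).val := by
  have := congrFun (finFunctionFinEquiv.symm_apply_apply fun i : Fin (h + 1) =>
    (⟨(taylorFunctional h ((k : ℕ) : ZMod p) (h - i) v + 1).val, ZMod.val_lt _⟩ : Fin p))
    ⟨i, Nat.lt_succ_of_le hi⟩
  exact congrArg Fin.val this

/-- A cell of shape `m` fixes the digits at places above `m k`, that is, the Taylor coefficients of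
order below `h - m k` at node `k`. Together these are at least `h` Hermite conditions on a
polynomial of degree below `h`; `d ≤ p` keeps the nodes distinct. -/
theorem hermitePoint_cell_injective (hd : d ≤ p) {m : Fin d → ℕ}
    (hsum : h ≤ ∑ k, (h - m k)) {v w : Fin h → ZMod p}
    (hvw : ∀ k, hermitePoint d p h v k / (p * p ^ m k) = hermitePoint d p h w k / (p * p ^ m k)) :
    v = w := by
  have ha : Function.Injective fun k : Fin d => ((k : ℕ) : ZMod p) := by
    intro k l hkl
    have := (ZMod.natCast_eq_natCast_iff' _ _ _).1 hkl
    rw [Nat.mod_eq_of_lt (k.2.trans_le hd), Nat.mod_eq_of_lt (l.2.trans_le hd)] at this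
    exact Fin.ext this
  refine eq_of_taylorFunctional_eq ha hsum fun k s hs => ?_
  have e : ∀ u : Fin h → ZMod p, hermitePoint d p h u k / p ^ (h - s) % p
      = hermitePoint d p h u k / (p * p ^ m k) / p ^ (h - s - (m k + 1)) % p := by
    intro u
    rw [Nat.div_div_eq_div_mul, ← pow_succ', ← pow_add]
    congr 3
    omega
  have hv := hermitePoint_digit v k (Nat.sub_le h s)
  have hw := hermitePoint_digit w k (Nat.sub_le h s)
  rw [e, Nat.sub_sub_self (by omega)] at hv hw
  rw [hvw k] at hv
  exact add_right_cancel (ZMod.val_injective p (hv.symm.trans hw))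

open Classical in
theorem card_not_isMiddle_mul_le (hp : 3 ≤ p) (k : Fin d) {i : ℕ} (hi : i ≤ h) :
    (Finset.univ.filter fun v => ¬ IsMiddle p (hermitePoint d p h v k / p ^ i % p)).card * p
      ≤ 2 * Fintype.card (Fin h → ZMod p) := by
  have : Fact (1 < p) := ⟨by omega⟩
  -- At place `0` the Taylor coefficient has order `h` and vanishes. The shift by one makes this
  -- digit `1`, which is middle because `p ≥ 3`.
  rcases Nat.eq_zero_or_pos i with rfl | hi0
  · have : (Finset.univ.filter fun v =>
        ¬ IsMiddle p (hermitePoint d p h v k / p ^ 0 % p)) = ∅ := by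
      refine Finset.filter_eq_empty_iff.2 fun v _ => not_not.2 ?_
      rw [hermitePoint_digit v k (Nat.zero_le h), Nat.sub_zero, taylorFunctional_degree_eq_zero,
        zero_add, ZMod.val_one]
      exact ⟨one_ne_zero, by omega⟩
    rw [this]
    simp
  let Z : ZMod p → Finset (Fin h → ZMod p) := fun c =>
    Finset.univ.filter fun v => taylorFunctional h ((k : ℕ) : ZMod p) (h - i) v = c
  have hZ : ∀ c, (Z c).card * p ≤ Fintype.card (Fin h → ZMod p) := by
    intro c
    have := card_taylorFunctional_fiber_mul_le (h := h) ((k : ℕ) : ZMod p) c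
      (s := h - i) (by omega)
    rw [ZMod.card] at this
    convert this
  have hsub : (Finset.univ.filter fun v => ¬ IsMiddle p (hermitePoint d p h v k / p ^ i % p))
      ⊆ Z (-1) ∪ Z (-2) := by
    intro v hv
    have hv' := (Finset.mem_filter.1 hv).2
    rw [hermitePoint_digit v k hi] at hv'
    simp only [Z, Finset.mem_union, Finset.mem_filter, Finset.mem_univ, true_and]
    unfold IsMiddle at hv'
    rw [not_and_or, not_not, not_not] at hv'
    rcases hv' with h0 | h1
    · left
      exact eq_neg_of_add_eq_zero_left ((ZMod.val_eq_zero _).1 h0)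
    · right
      have hv2 : (taylorFunctional h ((k : ℕ) : ZMod p) (h - i) v + 1) = -1 := by
        apply ZMod.val_injective p
        rw [h1, ZMod.val_neg_of_ne_zero, ZMod.val_one]
      rw [eq_sub_of_add_eq hv2]
      norm_num
  calc _ ≤ (Z (-1) ∪ Z (-2)).card * p := Nat.mul_le_mul_right _ (Finset.card_le_card hsub)
    _ ≤ ((Z (-1)).card + (Z (-2)).card) * p := Nat.mul_le_mul_right _ (Finset.card_union_le _ _)
    _ ≤ _ := by
      have h1 := hZ (-1)
      have h2 := hZ (-2)
      rw [add_mul]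
      omega

end

/-! ### Cell shapes and the discrepancy of the Hermite points -/

/-- A family of `(H + 1) ^ e` shapes of cells of equal volume. -/
def haarShapes (e H : ℕ) : Finset (Fin (e + 1) → ℕ) :=
  (Fintype.piFinset fun _ : Fin e => Finset.range (H + 1)).image fun s k =>
    -- The numbers of fixed digits are free in `[0, H]` in all coordinates but the first, which
    -- takes the remainder so that they total `(e + 1) * H`.
    (e + 1) * H - (Fin.cons ((e + 1) * H - ∑ i, s i) s : Fin (e + 1) → ℕ) k

theorem exists_of_mem_haarShapes {e H : ℕ} {m : Fin (e + 1) → ℕ} (hm : m ∈ haarShapes e H) :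
    (∀ k, m k ≤ (e + 1) * H) ∧ ∑ k, ((e + 1) * H - m k) = (e + 1) * H := by
  obtain ⟨s, hs, rfl⟩ := Finset.mem_image.1 hm
  have hs' : ∀ i, s i ≤ H := fun i =>
    Nat.lt_succ_iff.1 (Finset.mem_range.1 (Fintype.mem_piFinset.1 hs i))
  have hsum : ∑ i, s i ≤ (e + 1) * H := by
    calc ∑ i, s i ≤ ∑ _i : Fin e, H := Finset.sum_le_sum fun i _ => hs' i
      _ = e * H := by simp
      _ ≤ _ := Nat.mul_le_mul_right _ (Nat.le_succ e)
  have hr : ∀ k, (Fin.cons ((e + 1) * H - ∑ i, s i) s : Fin (e + 1) → ℕ) k ≤ (e + 1) * H := by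
    intro k
    refine Fin.cases ?_ (fun i => ?_) k
    · simp
    · rw [Fin.cons_succ]
      exact (hs' i).trans (Nat.le_mul_of_pos_left _ (Nat.succ_pos e))
  refine ⟨fun k => Nat.sub_le _ _, ?_⟩
  simp only [fun k => Nat.sub_sub_self (hr k)]
  rw [Fin.sum_univ_succ]
  simp only [Fin.cons_zero, Fin.cons_succ]
  exact Nat.sub_add_cancel hsum

theorem card_haarShapes (e H : ℕ) : (haarShapes e H).card = (H + 1) ^ e := by
  unfold haarShapes
  rw [Finset.card_image_of_injOn]
  · simp
  · intro s hs t ht hst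
    rw [Finset.mem_coe, Fintype.mem_piFinset] at hs ht
    funext i
    have h1 := congrFun hst i.succ
    simp only [Fin.cons_succ] at h1
    have h2 := Finset.mem_range.1 (hs i)
    have h3 := Finset.mem_range.1 (ht i)
    have h4 : H ≤ (e + 1) * H := Nat.le_mul_of_pos_left _ (Nat.succ_pos e)
    omega

open Classical in
/-- Every signing of a positive fraction of the Hermite points has large `L²` discrepancy with
respect to anchored boxes. -/
theorem sum_sq_hermitePoint_ge {e p H h : ℕ} [Fact p.Prime] (hh : h = (e + 1) * H)
    (hp : 3 ≤ p) (hpd : e + 1 ≤ p) {α : ℝ}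
    (hα : 0 < α) (hpα : 4 * ((e + 1 : ℕ) : ℝ) ≤ α * p)
    (z : (Fin h → ZMod p) → ℝ) (hz : ∀ j, z j = 0 ∨ z j ^ 2 = 1)
    (hsupp : α * p ^ h ≤ (Finset.univ.filter fun j => z j ≠ 0).card) :
    ((H : ℝ) + 1) ^ e * (α / 2) ^ 2 * (p : ℝ) ^ ((e + 1) * h) ≤
      p ^ (e + 1) * ∑ b ∈ gridBox (e + 1) (p ^ (h + 1)),
        (∑ j, if hermitePoint (e + 1) p h j ≤ b then z j else 0) ^ 2 := by
  have hmem : ∀ m ∈ haarShapes e H, (∀ k, m k ≤ h) ∧ ∑ k, (h - m k) = h := fun m hm =>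
    hh ▸ exists_of_mem_haarShapes hm
  have hp0 : (0 : ℝ) < p := by
    have : 0 < p := by omega
    exact_mod_cast this
  have hcard : (Fintype.card (Fin h → ZMod p) : ℝ) = (p : ℝ) ^ h := by
    simp [ZMod.card]
  have main := sum_sq_anchored_ge (by omega : 2 ≤ p) (hermitePoint (e + 1) p h) hermitePoint_lt
    (haarShapes e H) (fun m hm => (hmem m hm).1)
    (fun m hm j j' hjj => hermitePoint_cell_injective hpd
      (hmem m hm).2.ge hjj) ?_ z hz (γ := α / 2) (by positivity) ?_
  · rw [card_haarShapes] at main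
    push_cast at main
    exact main
  · intro m hm
    obtain ⟨h1, h2⟩ := hmem m hm
    rw [hcard, ← pow_add]
    congr 1
    calc h + ∑ k, m k = ∑ k, (h - m k) + ∑ k, m k := by rw [h2]
      _ = ∑ k : Fin (e + 1), h := by
          rw [← Finset.sum_add_distrib]
          exact Finset.sum_congr rfl fun k _ => Nat.sub_add_cancel (h1 k)
      _ = (e + 1) * h := by simp
  · intro m hm
    obtain ⟨h1, -⟩ := hmem m hm
    let bad : Fin (e + 1) → Finset (Fin h → ZMod p) := fun k =>
      Finset.univ.filter fun v => ¬ IsMiddle p (hermitePoint (e + 1) p h v k / p ^ m k % p)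
    have hbad : ∀ k, ((bad k).card : ℝ) ≤ 2 * p ^ h / p := by
      intro k
      rw [le_div_iff₀ hp0, ← hcard]
      exact_mod_cast card_not_isMiddle_mul_le hp k (h1 k)
    have hsub : (Finset.univ.filter fun j => z j ≠ 0) ⊆
        (Finset.univ.filter fun j => z j ≠ 0 ∧
          ∀ k, IsMiddle p (hermitePoint (e + 1) p h j k / p ^ m k % p)) ∪ Finset.univ.biUnion bad := by
      intro j hj
      have hj' := (Finset.mem_filter.1 hj).2
      by_cases hm : ∀ k, IsMiddle p (hermitePoint (e + 1) p h j k / p ^ m k % p)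
      · exact Finset.mem_union_left _ (by simp [hj', hm])
      · obtain ⟨k, hk⟩ := not_forall.1 hm
        exact Finset.mem_union_right _ (Finset.mem_biUnion.2 ⟨k, Finset.mem_univ _, by simp [bad, hk]⟩)
    have hcb : ((Finset.univ.biUnion bad).card : ℝ) ≤ ((e + 1 : ℕ) : ℝ) * (2 * p ^ h / p) := by
      calc ((Finset.univ.biUnion bad).card : ℝ) ≤ ∑ k, ((bad k).card : ℝ) := by
            exact_mod_cast Finset.card_biUnion_le
        _ ≤ ∑ _k : Fin (e + 1), 2 * (p : ℝ) ^ h / p := Finset.sum_le_sum fun k _ => hbad k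
        _ = _ := by simp
    have hu : ((Finset.univ.filter fun j => z j ≠ 0).card : ℝ) ≤
        (Finset.univ.filter fun j => z j ≠ 0 ∧
          ∀ k, IsMiddle p (hermitePoint (e + 1) p h j k / p ^ m k % p)).card
          + (Finset.univ.biUnion bad).card := by
      exact_mod_cast (Finset.card_le_card hsub).trans (Finset.card_union_le _ _)
    -- Non-middle digits cost at most a fraction `2 / p` per coordinate, hence at most half of the
    -- support in total; this is why `γ = α / 2`.
    have hfin : ((e + 1 : ℕ) : ℝ) * (2 * p ^ h / p) ≤ α / 2 * p ^ h := by
      rw [← mul_div_assoc, div_le_iff₀ hp0]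
      have := mul_le_mul_of_nonneg_right hpα (by positivity : (0 : ℝ) ≤ p ^ h)
      linarith
    rw [hcard]
    linarith

/-! ### From anchored boxes to all box ranges -/

section
variable {d G : ℕ} {J : Type*} [Fintype J]

/-- A grid point as a point of `ℝ^d`. -/
def toReal (q : Fin d → ℕ) : Fin d → ℝ := fun k => (q k : ℝ)

theorem toReal_injective : Function.Injective (toReal (d := d)) := fun _ _ h =>
  funext fun k => Nat.cast_injective (congrFun h k)

open Classical in
/-- The given grid points together with the integer points of absolute value less than `G` on the
coordinate axes. -/
noncomputable def withAxes (G : ℕ) (c : J → Fin d → ℕ) : Finset (Fin d → ℝ) :=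
  (Finset.univ.image fun j => toReal (c j)) ∪
    (Finset.univ ×ˢ Finset.Ioo (-(G : ℤ)) G).image fun x : Fin d × ℤ => Pi.single x.1 (x.2 : ℝ)

theorem toReal_mem_withAxes (c : J → Fin d → ℕ) (j : J) : toReal (c j) ∈ withAxes G c :=
  Finset.mem_union_left _ (Finset.mem_image_of_mem _ (Finset.mem_univ j))

theorem single_mem_withAxes (c : J → Fin d → ℕ) (k : Fin d) {t : ℤ} (h1 : -(G : ℤ) < t)
    (h2 : t < G) : Pi.single k (t : ℝ) ∈ withAxes G c :=
  Finset.mem_union_right _ (Finset.mem_image.2 ⟨(k, t), by simp [h1, h2], rfl⟩)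

theorem exists_int_of_mem_withAxes {c : J → Fin d → ℕ} (hc : ∀ j k, c j k < G)
    {q : Fin d → ℝ} (hq : q ∈ withAxes G c) (k : Fin d) :
    ∃ t : ℤ, -(G : ℤ) < t ∧ t < G ∧ q k = t := by
  rcases Finset.mem_union.1 hq with h | h
  · obtain ⟨j, -, rfl⟩ := Finset.mem_image.1 h
    have := hc j k
    exact ⟨c j k, by omega, by omega, by simp [toReal]⟩
  · obtain ⟨⟨l, t⟩, ht, rfl⟩ := Finset.mem_image.1 h
    have ht' := Finset.mem_Ioo.1 (Finset.mem_product.1 ht).2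
    by_cases hkl : k = l
    · subst hkl
      exact ⟨t, ht'.1, ht'.2, by simp⟩
    · exact ⟨0, by omega, by omega, by simp [hkl]⟩

theorem card_withAxes_le (c : J → Fin d → ℕ) :
    (withAxes G c).card ≤ Fintype.card J + d * (2 * G) := by
  refine (Finset.card_union_le _ _).trans (add_le_add Finset.card_image_le ?_)
  refine Finset.card_image_le.trans ?_
  rw [Finset.card_product, Finset.card_univ, Fintype.card_fin, Int.card_Ioo]
  exact Nat.mul_le_mul_left _ (by omega)

theorem le_card_withAxes {c : J → Fin d → ℕ} (hc : Function.Injective c) :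
    Fintype.card J ≤ (withAxes G c).card := by
  rw [← Finset.card_univ]
  exact Finset.card_le_card_of_injOn (fun j => toReal (c j))
    (fun j _ => toReal_mem_withAxes c j) (toReal_injective.comp hc).injOn

open Classical in
/-- The trace on `P` of the box `[-a, b]`. -/
noncomputable def centralRange (P : Finset (Fin d → ℝ)) (a b : Fin d → ℕ) :
    Finset (Fin d → ℝ) := P.filter fun q => q ∈ Set.Icc (-toReal a) (toReal b)

theorem centralRange_mem_boxRanges (P : Finset (Fin d → ℝ)) (a b : Fin d → ℕ) :
    centralRange P a b ∈ boxRanges P := by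
  classical
  rw [boxRanges, Finset.mem_filter]
  refine ⟨Finset.mem_powerset.2 (Finset.filter_subset _ _), -toReal a, toReal b, ?_⟩
  ext q
  simp [centralRange]

theorem toReal_mem_centralRange {P : Finset (Fin d → ℝ)} {a b q : Fin d → ℕ} (hq : toReal q ∈ P) :
    toReal q ∈ centralRange P a b ↔ q ≤ b := by
  simp only [centralRange, Finset.mem_filter, hq, true_and, Set.mem_Icc, Pi.le_def, toReal,
    Pi.neg_apply, Nat.cast_le, and_iff_right_iff_imp]
  intro _ k
  have h1 : (0 : ℝ) ≤ a k := Nat.cast_nonneg _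
  have h2 : (0 : ℝ) ≤ q k := Nat.cast_nonneg _
  linarith

theorem single_mem_centralRange {P : Finset (Fin d → ℝ)} {a b : Fin d → ℕ} {k : Fin d} {t : ℝ}
    (ht : Pi.single k t ∈ P) :
    Pi.single k t ∈ centralRange P a b ↔ -(a k : ℝ) ≤ t ∧ t ≤ b k := by
  simp only [centralRange, Finset.mem_filter, ht, true_and, Set.mem_Icc, Pi.le_def, toReal,
    Pi.neg_apply]
  constructor
  · rintro ⟨h1, h2⟩
    have h1 := h1 k
    have h2 := h2 k
    simp only [Pi.single_eq_same] at h1 h2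
    exact ⟨h1, h2⟩
  · rintro ⟨h1, h2⟩
    refine ⟨fun l => ?_, fun l => ?_⟩ <;> by_cases hl : l = k
    · subst hl; simpa using h1
    · simp [hl]
    · subst hl; simpa using h2
    · simp [hl]

/-- The axis points at `-a k` and `b k` lie in the range, so the range determines its corners. -/
theorem le_of_centralRange_eq {c : J → Fin d → ℕ} {a b a' b' : Fin d → ℕ}
    (ha : a ∈ gridBox d G) (hb : b ∈ gridBox d G)
    (h : centralRange (withAxes G c) a b = centralRange (withAxes G c) a' b') :
    a ≤ a' ∧ b ≤ b' := by
  have ha' : ∀ k, a k < G := fun k => Finset.mem_range.1 (Fintype.mem_piFinset.1 ha k)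
  have hb' : ∀ k, b k < G := fun k => Finset.mem_range.1 (Fintype.mem_piFinset.1 hb k)
  refine ⟨fun k => ?_, fun k => ?_⟩
  · have hk := ha' k
    have hm := single_mem_withAxes (G := G) c k (t := -(a k : ℤ)) (by omega) (by omega)
    have h1 := (single_mem_centralRange (a := a) (b := b) hm).2 (by
      push_cast
      exact ⟨le_rfl, by linarith [(Nat.cast_nonneg (a k) : (0 : ℝ) ≤ a k),
        (Nat.cast_nonneg (b k) : (0 : ℝ) ≤ b k)]⟩)
    rw [h, single_mem_centralRange hm] at h1
    have := h1.1
    push_cast at this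
    exact_mod_cast neg_le_neg_iff.1 this
  · have hk := hb' k
    have hm := single_mem_withAxes (G := G) c k (t := (b k : ℤ)) (by omega) (by omega)
    have h1 := (single_mem_centralRange (a := a) (b := b) hm).2 (by
      push_cast
      exact ⟨by linarith [(Nat.cast_nonneg (a k) : (0 : ℝ) ≤ a k),
        (Nat.cast_nonneg (b k) : (0 : ℝ) ≤ b k)], le_rfl⟩)
    rw [h, single_mem_centralRange hm] at h1
    have := h1.2
    push_cast at this
    exact_mod_cast this

theorem centralRange_injOn (c : J → Fin d → ℕ) :
    Set.InjOn (fun x : (Fin d → ℕ) × (Fin d → ℕ) => centralRange (withAxes G c) x.1 x.2)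
      (gridBox d G ×ˢ gridBox d G : Finset _) := by
  rintro ⟨a, b⟩ h1 ⟨a', b'⟩ h2 h
  rw [Finset.mem_coe, Finset.mem_product] at h1 h2
  have l1 := le_of_centralRange_eq h1.1 h1.2 h
  have l2 := le_of_centralRange_eq h2.1 h2.2 h.symm
  exact Prod.ext (le_antisymm l1.1 l2.1) (le_antisymm l1.2 l2.2)

/-- A set of points with bounded integer coordinates has few box ranges. -/
theorem card_boxRanges_le {P : Finset (Fin d → ℝ)}
    (hP : ∀ q ∈ P, ∀ k, ∃ t : ℤ, -(G : ℤ) < t ∧ t < G ∧ q k = t) :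
    (boxRanges P).card ≤ ((2 * G + 1) ^ d) ^ 2 := by
  classical
  let I : Finset (Fin d → ℤ) := Fintype.piFinset fun _ => Finset.Icc (-(G : ℤ)) G
  have hI : I.card = (2 * G + 1) ^ d := by
    simp only [I, Fintype.card_piFinset_const, Int.card_Icc]
    congr 1
    omega
  have hsub : boxRanges P ⊆ (I ×ˢ I).image fun x =>
      P.filter fun q => ∀ k, (x.1 k : ℝ) ≤ q k ∧ q k ≤ x.2 k := by
    intro R hR
    rw [boxRanges, Finset.mem_filter] at hR
    obtain ⟨-, a, b, hab⟩ := hR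
    -- All coordinates lie strictly between `-G` and `G`, so rounding the corners inward to integers
    -- and clipping them to `[-G, G]` leaves the trace unchanged.
    let clip : ℤ → ℤ := fun t => max (-(G : ℤ)) (min G t)
    have hclip : ∀ t, clip t ∈ Finset.Icc (-(G : ℤ)) G := by
      intro t
      simp only [clip, Finset.mem_Icc]
      omega
    refine Finset.mem_image.2 ⟨(fun k => clip ⌈a k⌉, fun k => clip ⌊b k⌋), ?_, ?_⟩
    · simp only [Finset.mem_product, I, Fintype.mem_piFinset]
      exact ⟨fun k => hclip _, fun k => hclip _⟩
    · ext q
      rw [← Finset.mem_coe (s := R), hab, Finset.mem_filter, Set.mem_inter_iff, Finset.mem_coe,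
        Set.mem_Icc]
      refine and_congr_right fun hq => ?_
      rw [Pi.le_def, Pi.le_def, ← forall_and]
      refine forall_congr' fun k => ?_
      obtain ⟨t, h1, h2, h3⟩ := hP q hq k
      have ea : a k ≤ t ↔ ⌈a k⌉ ≤ t := Int.ceil_le.symm
      have eb : (t : ℝ) ≤ b k ↔ t ≤ ⌊b k⌋ := Int.le_floor.symm
      rw [h3, ea, eb]
      simp only [Int.cast_le, clip]
      omega
  calc (boxRanges P).card ≤ _ := Finset.card_le_card hsub
    _ ≤ (I ×ˢ I).card := Finset.card_image_le
    _ = _ := by rw [Finset.card_product, hI, sq]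

open Classical in
/-- The mean square over all box ranges dominates the mean square over anchored boxes. -/
theorem avg_boxRanges_ge {c : J → Fin d → ℕ} (hc : ∀ j k, c j k < G) (hG : 0 < G) (z : J → ℝ) :
    (∑ b ∈ gridBox d G, (∑ j, if c j ≤ b then z j else 0) ^ 2) / (9 ^ d * G ^ d)
      ≤ 1 / ((boxRanges (withAxes G c)).card : ℝ) * ∑ R : boxRanges (withAxes G c),
        (∑ j, if toReal (c j) ∈ (R : Finset (Fin d → ℝ)) then z j else 0) ^ 2 := by
  set P := withAxes G c with hP
  let φ : Finset (Fin d → ℝ) → ℝ := fun R => (∑ j, if toReal (c j) ∈ R then z j else 0) ^ 2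
  have hGd : (0 : ℝ) < (G : ℝ) ^ d := by positivity
  have hcard0 : 0 < (boxRanges P).card :=
    Finset.card_pos.2 ⟨_, centralRange_mem_boxRanges P 0 0⟩
  have hcard : ((boxRanges P).card : ℝ) ≤ 9 ^ d * G ^ d * G ^ d := by
    calc ((boxRanges P).card : ℝ) ≤ (((2 * G + 1) ^ d) ^ 2 : ℕ) :=
          Nat.cast_le.2 (card_boxRanges_le fun q hq k => exists_int_of_mem_withAxes hc hq k)
      _ ≤ (((3 * G) ^ d) ^ 2 : ℕ) :=
          Nat.cast_le.2 (Nat.pow_le_pow_left (Nat.pow_le_pow_left (by omega) d) 2)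
      _ = _ := by
          push_cast
          rw [show (9 : ℝ) = 3 ^ 2 by norm_num, mul_pow, ← pow_mul, mul_comm 2 d, pow_mul]
          ring
  -- Each anchored box is counted once for every lower corner `a`, which gives `G ^ d` distinct
  -- ranges.
  have hsum : (G : ℝ) ^ d * ∑ b ∈ gridBox d G, (∑ j, if c j ≤ b then z j else 0) ^ 2
      ≤ ∑ R : boxRanges P, φ R := by
    calc _ = ∑ a ∈ gridBox d G, ∑ b ∈ gridBox d G, φ (centralRange P a b) := by
          have : ∀ a b, φ (centralRange P a b) = (∑ j, if c j ≤ b then z j else 0) ^ 2 := by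
            intro a b
            simp only [φ, toReal_mem_centralRange (hP ▸ toReal_mem_withAxes c _)]
          simp only [this]
          rw [Finset.sum_const, nsmul_eq_mul]
          simp [gridBox]
      _ = ∑ R ∈ (gridBox d G ×ˢ gridBox d G).image fun x => centralRange P x.1 x.2, φ R := by
          rw [Finset.sum_image (centralRange_injOn c), Finset.sum_product]
      _ ≤ ∑ R ∈ boxRanges P, φ R := by
          refine Finset.sum_le_sum_of_subset_of_nonneg ?_ fun R _ _ => sq_nonneg _
          intro R hR
          obtain ⟨x, -, rfl⟩ := Finset.mem_image.1 hR
          exact centralRange_mem_boxRanges P _ _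
      _ = _ := (Finset.sum_coe_sort _ _).symm
  have hD : 0 ≤ ∑ b ∈ gridBox d G, (∑ j, if c j ≤ b then z j else 0) ^ 2 :=
    Finset.sum_nonneg fun b _ => sq_nonneg _
  have hcR : (0 : ℝ) < (boxRanges P).card := by exact_mod_cast hcard0
  rw [one_div, inv_mul_eq_div, div_le_div_iff₀ (by positivity) hcR]
  calc _ ≤ (∑ b ∈ gridBox d G, (∑ j, if c j ≤ b then z j else 0) ^ 2)
        * (9 ^ d * G ^ d * G ^ d) := mul_le_mul_of_nonneg_left hcard hD
    _ = (G ^ d * ∑ b ∈ gridBox d G, (∑ j, if c j ≤ b then z j else 0) ^ 2) * (9 ^ d * G ^ d) := by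
        ring
    _ ≤ _ := mul_le_mul_of_nonneg_right hsum (by positivity)

end

/-! ### Boolean inputs and accurate answers -/

section
variable {d : ℕ} {P : Finset (Fin d → ℝ)} {U : Set ℤ} {J : Type*}

/-- The `0`/`1` weights of a Boolean vector, supported on the points `e j`. -/
noncomputable def boolWeights (hU : {0, 1} ⊆ U) (e : J → P) (w : J → Bool) : P → U :=
  Function.extend e (fun j => if w j then ⟨1, hU (by simp)⟩ else ⟨0, hU (by simp)⟩)
    fun _ => ⟨0, hU (by simp)⟩

theorem coe_boolWeights (hU : {0, 1} ⊆ U) {e : J → P} (he : Function.Injective e) (w : J → Bool)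
    (j : J) : (boolWeights hU e w (e j) : ℤ) = if w j then 1 else 0 := by
  rw [boolWeights, he.extend_apply]
  split_ifs <;> rfl

theorem coe_boolWeights_of_notMem (hU : {0, 1} ⊆ U) {e : J → P} (w : J → Bool) {q : P}
    (hq : q ∉ Set.range e) : (boolWeights hU e w q : ℤ) = 0 := by
  rw [boolWeights, Function.extend_apply' _ _ _ hq]

variable [Fintype J]

open Classical in
theorem rangeCount_boolWeights (hU : {0, 1} ⊆ U) {e : J → P} (he : Function.Injective e)
    (w : J → Bool) (R : Finset (Fin d → ℝ)) :
    rangeCount (boolWeights hU e w) R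
      = ∑ j, if (e j : Fin d → ℝ) ∈ R then (if w j then (1 : ℝ) else 0) else 0 := by
  unfold rangeCount
  symm
  refine Fintype.sum_of_injective e he _ _ (fun q hq => ?_) fun j => ?_
  · rw [coe_boolWeights_of_notMem hU w hq]
    simp
  · rw [coe_boolWeights hU he]
    push_cast
    rfl

theorem sum_abs_boolWeights_update_le [DecidableEq J] (hU : {0, 1} ⊆ U) {e : J → P}
    (he : Function.Injective e) (w : J → Bool) (i : J) (v : Bool) :
    ∑ q, |(boolWeights hU e w q : ℤ) - (boolWeights hU e (Function.update w i v) q : ℤ)| ≤ 1 := by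
  rw [← Fintype.sum_of_injective e he
    (fun j => |(if w j then (1 : ℤ) else 0) - if Function.update w i v j then 1 else 0|) _
    (fun q hq => ?_) fun j => ?_]
  · rw [Finset.sum_eq_single i (fun j _ hj => by simp [hj]) (by simp)]
    split_ifs <;> simp
  · simp [coe_boolWeights_of_notMem hU _ hq]
  · rw [coe_boolWeights hU he, coe_boolWeights hU he]

theorem measurable_avgSqError (x : P → U) : Measurable (avgSqError x) := by
  unfold avgSqError
  fun_prop

theorem avg_sq_rangeCount_sub_le {x x' : P → U} {y : boxRanges P → ℝ} {t : ℝ}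
    (h : avgSqError x y ≤ t) (h' : avgSqError x' y ≤ t) :
    1 / ((boxRanges P).card : ℝ) * ∑ R : boxRanges P, (rangeCount x R - rangeCount x' R) ^ 2
      ≤ 4 * t := by
  have key : ∑ R : boxRanges P, (rangeCount x R - rangeCount x' R) ^ 2
      ≤ 2 * ∑ R : boxRanges P, (y R - rangeCount x R) ^ 2
        + 2 * ∑ R : boxRanges P, (y R - rangeCount x' R) ^ 2 := by
    rw [Finset.mul_sum, Finset.mul_sum, ← Finset.sum_add_distrib]
    refine Finset.sum_le_sum fun R _ => ?_
    nlinarith [sq_nonneg (2 * y R - rangeCount x R - rangeCount x' R)]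
  have := mul_le_mul_of_nonneg_left key (by positivity : (0 : ℝ) ≤ 1 / (boxRanges P).card)
  unfold avgSqError at h h'
  linarith

/-- If weights on `e` that fit a common answer vector are `κ`-close, then an accurate mechanism on
`P` is private only for weak parameters. -/
theorem IsDifferentiallyPrivate.reconstruction_bound (hU : {0, 1} ⊆ U) {e : J → P}
    (he : Function.Injective e) {M : (P → U) → ProbabilityMeasure (boxRanges P → ℝ)}
    {p ε δ κ t : ℝ} (hM : IsDifferentiallyPrivate M ε δ) (hκ : 0 ≤ κ) (hκN : κ ≤ Fintype.card J)
    (hacc : ∀ x, p ≤ (M x : Measure (boxRanges P → ℝ)).real {y | avgSqError x y ≤ t})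
    (hclose : ∀ w w' : J → Bool, 1 / ((boxRanges P).card : ℝ) * ∑ R : boxRanges P,
        (rangeCount (boolWeights hU e w) R - rangeCount (boolWeights hU e w') R) ^ 2 ≤ 4 * t →
      ((Finset.univ.filter fun i => w i ≠ w' i).card : ℝ) ≤ κ) :
    (Fintype.card J - κ) * p ≤ Fintype.card J * δ + Real.exp ε * (κ + 1) := by
  classical
  refine _root_.reconstruction_bound
    (fun w : J → Bool => (M (boolWeights hU e w) : Measure (boxRanges P → ℝ)))
    (fun w => {y | avgSqError (boolWeights hU e w) y ≤ t})
    (fun w => measurableSet_le (measurable_avgSqError _) measurable_const) hκ hκN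
    (fun w => hacc _) ?_ ?_
  · rintro w w' ⟨y, hy, hy'⟩
    exact hclose w w' (avg_sq_rangeCount_sub_le hy hy')
  · intro w i S hS
    exact hM _ _ (sum_abs_boolWeights_update_le hU he w i _) S hS

end

/-! ### Parameters and conclusion -/

open Classical in
/-- Discrepancy lower bound for the box ranges of the Hermite points with axes. -/
theorem avg_boxRanges_hermitePoint_ge {e p H h : ℕ} [Fact p.Prime] (hh : h = (e + 1) * H)
    (hp : 3 ≤ p) (hpd : e + 1 ≤ p) {α : ℝ} (hα : 0 < α)
    (hpα : 4 * ((e + 1 : ℕ) : ℝ) ≤ α * p) (z : (Fin h → ZMod p) → ℝ)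
    (hz : ∀ j, z j = 0 ∨ z j ^ 2 = 1)
    (hsupp : α * p ^ h ≤ (Finset.univ.filter fun j => z j ≠ 0).card) :
    (α / 2) ^ 2 / (9 ^ (e + 1) * p ^ (e + 1) * p ^ (e + 1)) * ((H : ℝ) + 1) ^ e
      ≤ 1 / ((boxRanges (withAxes (p ^ (h + 1)) (hermitePoint (e + 1) p h))).card : ℝ) *
        ∑ R : boxRanges (withAxes (p ^ (h + 1)) (hermitePoint (e + 1) p h)),
        (∑ j, if toReal (hermitePoint (e + 1) p h j) ∈ (R : Finset (Fin (e + 1) → ℝ))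
          then z j else 0) ^ 2 := by
  have hp0 : (0 : ℝ) < p := by
    have : 0 < p := by omega
    exact_mod_cast this
  refine le_trans ?_ (avg_boxRanges_ge hermitePoint_lt (pow_pos (by omega) _) z)
  have main := sum_sq_hermitePoint_ge hh hp hpd hα hpα z hz hsupp
  have e1 : ((p ^ (h + 1) : ℕ) : ℝ) ^ (e + 1) = (p : ℝ) ^ ((e + 1) * h) * p ^ (e + 1) := by
    push_cast
    ring
  rw [e1, div_mul_eq_mul_div, div_le_div_iff₀ (by positivity) (by positivity)]
  calc _ = (((H : ℝ) + 1) ^ e * (α / 2) ^ 2 * (p : ℝ) ^ ((e + 1) * h))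
        * (9 ^ (e + 1) * p ^ (e + 1)) := by ring
    _ ≤ _ := mul_le_mul_of_nonneg_right main (by positivity)
    _ = _ := by ring

/-- Since `G = p ^ (h + 1)` is only `p` times the number of Hermite points, the axis points do not
change the order of `log n`. -/
theorem log_card_withAxes_le {e p H h : ℕ} [Fact p.Prime] (hh : h = (e + 1) * H) :
    Real.log ((withAxes (p ^ (h + 1)) (hermitePoint (e + 1) p h)).card : ℝ)
      ≤ (Real.log (2 * (e + 1 : ℕ) + 1) + ((e + 1 : ℕ) + 1) * Real.log p) * ((H : ℝ) + 1) := by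
  have hp1 : 1 ≤ p := (Fact.out : p.Prime).one_le
  have hp0 : (0 : ℝ) < p := by exact_mod_cast hp1
  have hlogp : 0 ≤ Real.log p := Real.log_nonneg (by exact_mod_cast hp1)
  have hlog2 : 0 ≤ Real.log (2 * (e + 1 : ℕ) + 1) :=
    Real.log_nonneg (by linarith [(Nat.cast_nonneg (e + 1) : (0 : ℝ) ≤ (e + 1 : ℕ))])
  set n := (withAxes (p ^ (h + 1)) (hermitePoint (e + 1) p h)).card with hn
  rcases Nat.eq_zero_or_pos n with h0 | h0
  · rw [h0, Nat.cast_zero, Real.log_zero]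
    positivity
  have hle : n ≤ (2 * (e + 1) + 1) * p ^ (h + 1) := by
    have h1 := card_withAxes_le (G := p ^ (h + 1)) (hermitePoint (e + 1) p h)
    have h2 : Fintype.card (Fin h → ZMod p) ≤ p ^ (h + 1) := by
      simpa [ZMod.card] using Nat.pow_le_pow_right hp1 (Nat.le_succ h)
    calc n ≤ _ := h1
      _ ≤ p ^ (h + 1) + (e + 1) * (2 * p ^ (h + 1)) := Nat.add_le_add_right h2 _
      _ = _ := by ring
  have hle' : (n : ℝ) ≤ (2 * (e + 1 : ℕ) + 1) * (p : ℝ) ^ (h + 1) := by exact_mod_cast hle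
  calc Real.log n ≤ Real.log ((2 * (e + 1 : ℕ) + 1) * (p : ℝ) ^ (h + 1)) :=
        Real.log_le_log (by exact_mod_cast h0) hle'
    _ = Real.log (2 * (e + 1 : ℕ) + 1) * 1 + ((h : ℝ) + 1) * Real.log p := by
        rw [Real.log_mul (by positivity) (by positivity), Real.log_pow]
        push_cast
        ring
    _ ≤ Real.log (2 * (e + 1 : ℕ) + 1) * ((H : ℝ) + 1)
        + ((((e + 1 : ℕ) : ℝ) + 1) * ((H : ℝ) + 1)) * Real.log p := by
        have hH : (0 : ℝ) ≤ H := Nat.cast_nonneg H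
        refine add_le_add (mul_le_mul_of_nonneg_left (by linarith) hlog2)
          (mul_le_mul_of_nonneg_right ?_ hlogp)
        rw [hh]
        push_cast
        nlinarith [(Nat.cast_nonneg e : (0 : ℝ) ≤ e)]
    _ = _ := by ring

theorem mainTheorem6 (d : ℕ) (hd : 1 ≤ d) (U : Set ℤ) (hU : {0, 1} ⊆ U)
    (M : OrthogonalRangeMechanism U d) (p : ℝ) (err : ℕ → ℝ)
    (herr : err =o[atTop] fun n : ℕ => Real.log n ^ (d - 1))
    (hacc : ∀ᶠ n : ℕ in atTop, ∀ P : Finset (Fin d → ℝ), P.card = n → ∀ x : P → U,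
      p ≤ (M P x : Measure (boxRanges P → ℝ)).real {y | avgSqError x y ≤ err n})
    (ε δ : ℝ) (hε : 0 ≤ ε) (hδ : 0 ≤ δ) (hδp : δ < p) :
    ¬ ∀ P : Finset (Fin d → ℝ), IsDifferentiallyPrivate (M P) ε δ := by
  classical
  intro hDP
  obtain ⟨e, rfl⟩ : ∃ e, d = e + 1 := ⟨d - 1, by omega⟩
  rw [Nat.add_sub_cancel] at herr
  have hE : 0 < Real.exp ε := Real.exp_pos ε
  have hp0 : 0 < p := hδ.trans_lt hδp
  -- With closeness `α * N` and `1 ≤ α * N`, the reconstruction bound would give `p - δ ≤ α * (p + 2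
  -- * exp ε)`.
  obtain ⟨α, hα0, hα1, hα⟩ : ∃ α : ℝ, 0 < α ∧ α ≤ 1 ∧ α * (p + 2 * Real.exp ε) < p - δ := by
    have hpos : 0 < p + 2 * Real.exp ε := by positivity
    refine ⟨(p - δ) / (2 * (p + 2 * Real.exp ε)), div_pos (by linarith) (by positivity), ?_, ?_⟩
    · rw [div_le_one (by positivity)]
      linarith
    · rw [div_mul_eq_mul_div, div_lt_iff₀ (by positivity)]
      nlinarith
  obtain ⟨r, hr, hrp⟩ := Nat.exists_infinite_primes (3 + (e + 1) + ⌈4 * ((e + 1 : ℕ) : ℝ) / α⌉₊)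
  have : Fact r.Prime := ⟨hrp⟩
  have hr3 : 3 ≤ r := by omega
  have hrd : e + 1 ≤ r := by omega
  have hr0 : (0 : ℝ) < r := by exact_mod_cast hrp.pos
  have hrα : 4 * ((e + 1 : ℕ) : ℝ) ≤ α * r := by
    rw [mul_comm α, ← div_le_iff₀ hα0]
    exact (Nat.le_ceil _).trans (Nat.cast_le.2 (by omega))
  set C : ℝ := Real.log (2 * (e + 1 : ℕ) + 1) + ((e + 1 : ℕ) + 1) * Real.log r with hC
  have hC0 : 0 < C := by
    have h1 : 0 < Real.log r := Real.log_pos (by exact_mod_cast hrp.one_lt)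
    have h2 : 0 ≤ Real.log (2 * (e + 1 : ℕ) + 1) :=
      Real.log_nonneg (by linarith [(Nat.cast_nonneg (e + 1) : (0 : ℝ) ≤ (e + 1 : ℕ))])
    positivity
  set κ : ℝ := (α / 2) ^ 2 / (9 ^ (e + 1) * r ^ (e + 1) * r ^ (e + 1)) with hκ
  have hκ0 : 0 < κ := by positivity
  -- As `log n ≤ C * (H + 1)`, this constant makes four times the error at most half of the
  -- discrepancy bound `κ * (H + 1) ^ e`.
  have herr' := herr.bound (c := κ / (8 * C ^ e)) (by positivity)
  let h : ℕ → ℕ := fun H => (e + 1) * H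
  let P : ℕ → Finset (Fin (e + 1) → ℝ) := fun H =>
    withAxes (r ^ (h H + 1)) (hermitePoint (e + 1) r (h H))
  have hinj : ∀ H, Function.Injective (hermitePoint (e + 1) r (h H)) := fun H v w hvw =>
    hermitePoint_cell_injective (m := fun _ => 0) hrd
      (by simpa using Nat.le_mul_of_pos_left (h H) (Nat.succ_pos e)) fun k => by rw [hvw]
  have hJ : ∀ H, Fintype.card (Fin (h H) → ZMod r) = r ^ h H := fun H => by simp [ZMod.card]
  have hHle : ∀ H, H ≤ r ^ h H := fun H =>
    (Nat.le_mul_of_pos_left H (Nat.succ_pos e)).trans (Nat.lt_pow_self hrp.one_lt).le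
  have hcardP : Tendsto (fun H => (P H).card) atTop atTop :=
    tendsto_atTop_mono (fun H => (hHle H).trans ((hJ H).symm.le.trans (le_card_withAxes (hinj H))))
      tendsto_id
  obtain ⟨H, hH1, hH2, hH3⟩ := ((hcardP.eventually hacc).and ((hcardP.eventually herr').and
    (eventually_ge_atTop ⌈1 / α⌉₊))).exists
  have hN : 1 ≤ α * (r : ℝ) ^ h H := by
    rw [mul_comm, ← div_le_iff₀ hα0]
    refine (Nat.le_ceil _).trans ?_
    exact_mod_cast hH3.trans (hHle H)
  have herrH : err (P H).card ≤ κ / 8 * ((H : ℝ) + 1) ^ e := by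
    have hlog : 0 ≤ Real.log ((P H).card : ℝ) := Real.log_natCast_nonneg _
    have hb := pow_le_pow_left₀ hlog (log_card_withAxes_le (p := r) (e := e) (H := H) rfl) e
    rw [← hC, mul_pow] at hb
    calc err (P H).card ≤ ‖err (P H).card‖ := Real.le_norm_self _
      _ ≤ κ / (8 * C ^ e) * Real.log ((P H).card : ℝ) ^ e := by
          rwa [Real.norm_of_nonneg (pow_nonneg hlog e)] at hH2
      _ ≤ κ / (8 * C ^ e) * (C ^ e * ((H : ℝ) + 1) ^ e) :=
          mul_le_mul_of_nonneg_left hb (by positivity)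
      _ = _ := by field_simp
  let E : (Fin (h H) → ZMod r) → P H := fun j => ⟨_, toReal_mem_withAxes _ j⟩
  have hEinj : Function.Injective E := fun v w hvw =>
    hinj H (toReal_injective (congrArg Subtype.val hvw))
  have hbound := (hDP (P H)).reconstruction_bound hU hEinj (κ := α * r ^ h H) (by positivity)
    (by rw [hJ]; push_cast; exact mul_le_of_le_one_left (by positivity) hα1)
    (hH1 (P H) rfl) ?_
  · rw [hJ] at hbound
    push_cast at hbound
    have hX : (0 : ℝ) < (r : ℝ) ^ h H := by positivity
    have h1 := mul_lt_mul_of_pos_right hα hX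
    have h2 := mul_le_mul_of_nonneg_left hN hE.le
    linarith
  · intro w w' hww
    by_contra hcon
    push Not at hcon
    -- The difference of two weightings is a signing supported where they differ, so discrepancy
    -- becomes distance between answer vectors.
    let z : (Fin (h H) → ZMod r) → ℝ := fun j => (if w j then 1 else 0) - if w' j then 1 else 0
    have hzne : ∀ j, z j ≠ 0 ↔ w j ≠ w' j := by
      intro j
      simp only [z]
      cases w j <;> cases w' j <;> simp
    have hz : ∀ j, z j = 0 ∨ z j ^ 2 = 1 := by
      intro j
      simp only [z]
      cases w j <;> cases w' j <;> simp
    have hlow := avg_boxRanges_hermitePoint_ge (h := h H) rfl hr3 hrd hα0 hrα z hz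
      (by simpa only [hzne] using hcon.le)
    have hdiff : ∀ R : Finset (Fin (e + 1) → ℝ),
        rangeCount (boolWeights hU E w) R - rangeCount (boolWeights hU E w') R
        = ∑ j, if toReal (hermitePoint (e + 1) r (h H) j) ∈ R then z j else 0 := by
      intro R
      rw [rangeCount_boolWeights hU hEinj, rangeCount_boolWeights hU hEinj,
        ← Finset.sum_sub_distrib]
      refine Finset.sum_congr rfl fun j _ => ?_
      simp only [E, z]
      split_ifs <;> simp
    simp only [hdiff] at hww
    have hlow' := hlow.trans hww
    have hpos : 0 < κ * ((H : ℝ) + 1) ^ e := by positivity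
    linarith
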